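/- Let $r\ge 1$ and let $1\le m_k\le n_k$ be integers for $k=1,\dots,r$. Assume that $m_k<n_k$ for at least one $k$, or that $n_k\ge 2$ for at least two indices $k$. Put $\mathbb U=\mathbb R^{m_1\times\cdots\times m_r}$ and $\mathbb V=\mathbb R^{n_1\times\cdots\times n_r}$ with their Frobenius inner products. For matrices $\mathbf A=(A_1,\dots,A_r)$, $A_k\in\mathbb R^{n_k\times m_k}$, and $T\in\mathbb U$ let $\mathbf A\cdot T\in\mathbb V$ be the Tucker product, $$(\mathbf A\cdot T)_{i_1,\dots,i_r}=\sum_{j_1,\dots,j_r}(A_1)_{i_1j_1}\cdots(A_r)_{i_rj_r}\,T_{j_1,\dots,j_r}.$$ The probabilistic tensor PCA (TPCA) model is the set of distributions of all random tensors $$X=\mathbf A\cdot\nu+\mathbf A\cdot Z+\varepsilon\in\mathbb V,$$ where $Z$ is standard normal on $\mathbb U$, $\varepsilon\sim N(0,\sigma^2\,\mathrm{Id}_{\mathbb V})$ is independent of $Z$, and the parameters are arbitrary matrices $A_k\in\mathbb R^{n_k\times m_k}$, $\sigma\ge 0$, and $\nu\in\mathbb U$, where $\nu$ is either fixed to be $0$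 or free. Its members are Gaussian; identify each of them with its pair (mean, covariance), so that the model becomes a subset of a finite-dimensional real vector space, and let its dimension be the Hausdorff dimension of this (semialgebraic) set. Then the TPCA model with $\nu=0$ has dimension $$2+\sum_{k=1}^r\left(n_km_k-\binom{m_k}{2}-1\right),$$ and the TPCA model with free $\nu$ has dimension $$2+\sum_{k=1}^r\left(n_km_k-\binom{m_k}{2}-1\right)+\prod_{k=1}^r m_k .$$ -/

import Mathlib

open MeasureTheory ProbabilityTheory
open scoped ENNReal

noncomputable section

/-- The inner product space `ℝ^{n₁ × ⋯ × n_r}` of real arrays, with the Frobenius inner product. -/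
abbrev Tensor {r : ℕ} (n : Fin r → ℕ) : Type :=
  EuclideanSpace ℝ (∀ k, Fin (n k))

/-- The Tucker product
`(A · T)_{i₁,…,i_r} = ∑_{j₁,…,j_r} (A₁)_{i₁ j₁} ⋯ (A_r)_{i_r j_r} T_{j₁,…,j_r}`. -/
def tucker {r : ℕ} {n m : Fin r → ℕ} (A : ∀ k, Matrix (Fin (n k)) (Fin (m k)) ℝ)
    (T : Tensor m) : Tensor n :=
  WithLp.toLp 2 fun i => ∑ j : ∀ k, Fin (m k), (∏ k, A k (i k) (j k)) * T j

/-- The random tensor `X` on the probability space `(Ω, P)` follows the probabilistic tensor PCA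
model with parameters `A`, `ν`, `σ`: it is `X = A · ν + A · Z + ε` with `Z` standard normal,
`ε ∼ N(0, σ² I)`, and `Z`, `ε` independent. -/
def IsTPCA {r : ℕ} {n m : Fin r → ℕ} {Ω : Type} [MeasurableSpace Ω] (P : Measure Ω)
    (X : Ω → Tensor n) (A : ∀ k, Matrix (Fin (n k)) (Fin (m k)) ℝ) (ν : Tensor m) (σ : ℝ) :
    Prop :=
  ∃ (Z : Ω → Tensor m) (ε : Ω → Tensor n),
    HasLaw Z (stdGaussian (Tensor m)) P ∧
    HasLaw ε (multivariateGaussian 0 (σ ^ 2 • (1 : Matrix _ _ ℝ))) P ∧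
    IndepFun Z ε P ∧
    ∀ ω, X ω = tucker A ν + tucker A (Z ω) + ε ω

/-- The probabilistic tensor PCA model whose core mean `ν` ranges over the set `N`, as the set of
all distributions of random tensors that follow it. -/
def tpcaModel {r : ℕ} (n m : Fin r → ℕ) (N : Set (Tensor m)) : Set (Measure (Tensor n)) :=
  {Q | ∃ (Ω : Type) (_ : MeasurableSpace Ω) (P : Measure Ω) (X : Ω → Tensor n)
      (A : ∀ k, Matrix (Fin (n k)) (Fin (m k)) ℝ) (ν : Tensor m) (σ : ℝ),
      IsProbabilityMeasure P ∧ ν ∈ N ∧ 0 ≤ σ ∧ IsTPCA P X A ν σ ∧ HasLaw X Q P}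

/-- The mean and the (centred) covariance form of a distribution on a tensor space. They determine
a Gaussian distribution, so they are coordinates on every Gaussian model. -/
def meanCov {r : ℕ} {n : Fin r → ℕ} (Q : Measure (Tensor n)) :
    Tensor n × (Tensor n →L[ℝ] Tensor n →L[ℝ] ℝ) :=
  (∫ x, x ∂Q, covarianceBilin Q)

/-- The dimension of a Gaussian model: the Hausdorff dimension of the set of the pairs
(mean, covariance) of its members in the finite-dimensional space of all such pairs. On
semialgebraic sets, such as the model above, it is the usual dimension. -/
def modelDim {r : ℕ} {n : Fin r → ℕ} (M : Set (Measure (Tensor n))) : ℝ≥0∞ :=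
  dimH (meanCov '' M)

end

/-!
The moments of `𝐀 · ν + 𝐀 · Z + ε` are `(B ν, B Bᵀ + σ² I)`, where `B` is the Kronecker product of
the `A k`. They do not change when `B` is replaced by `B Q` with `Q` orthogonal and `ν` by `Qᵀ ν`,
so by LQ decomposition every `A k` may be taken lower trapezoidal; as only the product of the scales
of the factors matters, one entry of each nonzero `A k` may moreover be normalised to `1`. There are
finitely many choices of normalised entries, so finitely many `C¹` maps on vector spaces of the
asserted dimension cover the set of moments. This is the upper bound, since `C¹` maps do not raise
the Hausdorff dimension.

For the lower bound it suffices that one of these maps is an immersion at one point. Take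
`A k = L k` with diagonal `1, 2, 2, …`, normalised at the corner, and put `S k = L k (L k)ᵀ`. A
tangent vector in the kernel gives a relation `2τ ⨂ S k + (derivative of ⨂ S k along T) + 2ρ I = 0`,
where `T k = L k (D k)ᵀ + D k (L k)ᵀ` vanishes at the corner. On the entries that differ from the
corner in a single factor it reads `2τ S k + T k + 2ρ I = 0`, in particular `τ + ρ = 0`. If
`m k < n k`, then `S k` and `T k` have a common zero on the diagonal and `ρ = 0`; if two factors
have a diagonal entry of `S k` different from `1`, the relation at this pair of entries gives
`τ = 0`. So `T = 0`, and `D k (L k)ᵀ`, which is lower triangular with vanishing symmetric part, is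
`0` as well.
-/

noncomputable section

open scoped Matrix Matrix.Norms.Elementwise

section PiKronecker

variable {ι R : Type*} {α β γ : ι → Type*} [Fintype ι] [CommSemiring R] [TopologicalSpace R]
  [IsTopologicalSemiring R]

/-- The Kronecker product of a family of matrices, as a continuous multilinear map of the family.
Its rows and columns are indexed by the tuples of rows and columns of the factors, so that a Tucker
product is a matrix-vector product. -/
def piKronecker :
    ContinuousMultilinearMap R (fun k => Matrix (α k) (β k) R)
      (Matrix (∀ k, α k) (∀ k, β k) R) where
  toFun A := Matrix.of fun i j => ∏ k, A k (i k) (j k)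
  map_update_add' A k X Y := by
    classical
    ext i j
    exact ((MultilinearMap.mkPiAlgebra R ι R).compLinearMap fun k =>
      Matrix.entryLinearMap R R (i k) (j k)).map_update_add A k X Y
  map_update_smul' A k s X := by
    ext i j
    exact ((MultilinearMap.mkPiAlgebra R ι R).compLinearMap fun k =>
      Matrix.entryLinearMap R R (i k) (j k)).map_update_smul A k s X
  cont := continuous_matrix fun i j =>
    continuous_finsetProd _ fun k _ => (continuous_apply k).matrix_elem (i k) (j k)

theorem piKronecker_apply (A : ∀ k, Matrix (α k) (β k) R) (i : ∀ k, α k) (j : ∀ k, β k) :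
    piKronecker A i j = ∏ k, A k (i k) (j k) :=
  rfl

theorem transpose_piKronecker (A : ∀ k, Matrix (α k) (β k) R) :
    (piKronecker A)ᵀ = piKronecker fun k => (A k)ᵀ :=
  rfl

theorem piKronecker_mul [DecidableEq ι] [∀ k, Fintype (β k)] (A : ∀ k, Matrix (α k) (β k) R)
    (B : ∀ k, Matrix (β k) (γ k) R) :
    piKronecker A * piKronecker B = piKronecker fun k => A k * B k := by
  ext i j
  simp only [Matrix.mul_apply, piKronecker_apply, Fintype.prod_sum, Finset.prod_mul_distrib]

theorem piKronecker_one [∀ k, DecidableEq (α k)] :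
    piKronecker (fun k => (1 : Matrix (α k) (α k) R)) = 1 := by
  ext i j
  simp only [piKronecker_apply, Matrix.one_apply, Fintype.prod_ite_zero, Finset.prod_const_one,
    funext_iff]

theorem piKronecker_mul_transpose_eq_one [DecidableEq ι] [∀ k, Fintype (β k)]
    [∀ k, DecidableEq (α k)] {Q : ∀ k, Matrix (α k) (β k) R} (hQ : ∀ k, Q k * (Q k)ᵀ = 1) :
    piKronecker Q * (piKronecker Q)ᵀ = 1 := by
  simp only [transpose_piKronecker, piKronecker_mul, hQ, piKronecker_one]

theorem piKronecker_update_mul [DecidableEq ι] [∀ k, Fintype (β k)]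
    (A : ∀ k, Matrix (α k) (β k) R) (B : ∀ k, Matrix (β k) (γ k) R) (k : ι)
    (X : Matrix (α k) (β k) R) :
    piKronecker (Function.update A k X) * piKronecker B =
      piKronecker (Function.update (fun l => A l * B l) k (X * B k)) := by
  rw [piKronecker_mul]
  congr 1
  ext1 l
  obtain rfl | hl := eq_or_ne l k <;> simp [*]

theorem piKronecker_mul_update [DecidableEq ι] [∀ k, Fintype (β k)]
    (A : ∀ k, Matrix (α k) (β k) R) (B : ∀ k, Matrix (β k) (γ k) R) (k : ι)
    (Y : Matrix (β k) (γ k) R) :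
    piKronecker A * piKronecker (Function.update B k Y) =
      piKronecker (Function.update (fun l => A l * B l) k (A k * Y)) := by
  rw [piKronecker_mul]
  congr 1
  ext1 l
  obtain rfl | hl := eq_or_ne l k <;> simp [*]

theorem piKronecker_linearDeriv_apply [DecidableEq ι] (A D : ∀ k, Matrix (α k) (β k) R)
    (i : ∀ k, α k) (j : ∀ k, β k) :
    piKronecker.linearDeriv A D i j =
      ∑ k, (∏ l ∈ Finset.univ.erase k, A l (i l) (j l)) * D k (i k) (j k) := by
  simp only [ContinuousMultilinearMap.linearDeriv_apply, Matrix.sum_apply, piKronecker_apply]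
  refine Finset.sum_congr rfl fun k _ => ?_
  rw [← Finset.prod_erase_mul _ _ (Finset.mem_univ k), Function.update_self]
  congr 1
  exact Finset.prod_congr rfl fun l hl => by rw [Function.update_of_ne (Finset.ne_of_mem_erase hl)]

theorem piKronecker_mul_transpose_linearDeriv_add [DecidableEq ι] [∀ k, Fintype (β k)]
    (A D : ∀ k, Matrix (α k) (β k) R) :
    piKronecker A * (piKronecker.linearDeriv A D)ᵀ +
        piKronecker.linearDeriv A D * (piKronecker A)ᵀ =
      piKronecker.linearDeriv (fun k => A k * (A k)ᵀ)
        (fun k => A k * (D k)ᵀ + D k * (A k)ᵀ) := by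
  simp only [ContinuousMultilinearMap.linearDeriv_apply, Matrix.transpose_sum, Matrix.mul_sum,
    Matrix.sum_mul, transpose_piKronecker, ← Finset.sum_add_distrib,
    ContinuousMultilinearMap.map_update_add, piKronecker_update_mul,
    Function.apply_update fun _ X => Xᵀ, piKronecker_mul_update]

end PiKronecker

theorem toEuclideanLin_piKronecker_injective {ι : Type*} {α β : ι → Type*} [Fintype ι]
    [DecidableEq ι] [∀ k, Fintype (α k)] [∀ k, Fintype (β k)] [∀ k, DecidableEq (β k)]
    {A : ∀ k, Matrix (α k) (β k) ℝ} {B : ∀ k, Matrix (β k) (α k) ℝ} (h : ∀ k, B k * A k = 1) :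
    Function.Injective (Matrix.toEuclideanLin (piKronecker A)) := by
  classical
  refine Function.LeftInverse.injective (g := Matrix.toEuclideanLin (piKronecker B)) fun x => ?_
  rw [← LinearMap.comp_apply, ← Matrix.toLpLin_mul_same, piKronecker_mul]
  simp only [h, piKronecker_one, Matrix.toLpLin_one, LinearMap.id_apply]

theorem tucker_eq_toEuclideanLin {r : ℕ} {n m : Fin r → ℕ}
    (A : ∀ k, Matrix (Fin (n k)) (Fin (m k)) ℝ) (T : Tensor m) :
    tucker A T = Matrix.toEuclideanLin (piKronecker A) T :=
  rfl

section LowerTrapezoidal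

variable {R : Type*} {n m : ℕ}

/-- A rectangular matrix whose entries above the diagonal vanish. -/
def IsLowerTrapezoidal [Zero R] (L : Matrix (Fin n) (Fin m) R) : Prop :=
  ∀ (i : Fin n) (j : Fin m), (i : ℕ) < j → L i j = 0

theorem exists_isLowerTrapezoidal_mul_orthogonal (hmn : m ≤ n) (A : Matrix (Fin n) (Fin m) ℝ) :
    ∃ (L : Matrix (Fin n) (Fin m) ℝ) (Q : Matrix (Fin m) (Fin m) ℝ),
      IsLowerTrapezoidal L ∧ Q * Qᵀ = 1 ∧ A = L * Q := by
  -- Gram–Schmidt applied to the first `m` rows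
  let f : Fin m → EuclideanSpace ℝ (Fin m) := fun i => WithLp.toLp 2 (A (Fin.castLE hmn i))
  let b := InnerProductSpace.gramSchmidtOrthonormalBasis (𝕜 := ℝ) (by simp) f
  refine ⟨Matrix.of fun i j => inner ℝ (b j) (WithLp.toLp 2 (A i)), Matrix.of fun i j => b i j,
    fun i j hij => ?_, ?_, ?_⟩
  · have h := InnerProductSpace.gramSchmidtOrthonormalBasis_inv_triangular (𝕜 := ℝ)
      (by simp) f (i := ⟨i, hij.trans j.2⟩) (j := j) hij
    simpa [f] using h
  · ext i j
    have h := orthonormal_iff_ite.1 b.orthonormal i j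
    simpa [Matrix.mul_apply, Matrix.one_apply, PiLp.inner_apply, mul_comm] using h
  · ext i j
    have h := congrArg (fun v : EuclideanSpace ℝ (Fin m) => v j)
      (b.sum_repr' (WithLp.toLp 2 (A i)))
    simpa [Matrix.mul_apply] using h.symm

theorem IsLowerTrapezoidal.eq_zero_of_add_transpose_eq_zero [AddMonoid R] [IsAddTorsionFree R]
    {L : Matrix (Fin n) (Fin n) R} (hL : IsLowerTrapezoidal L) (h : L + Lᵀ = 0) : L = 0 := by
  ext i j
  have hij : L i j + L j i = 0 := congrFun (congrFun h i) j
  obtain hlt | rfl | hlt := lt_trichotomy i j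
  · exact hL i j hlt
  · rw [← two_nsmul] at hij
    exact (nsmul_eq_zero_iff_right two_ne_zero).1 hij
  · rwa [hL j i hlt, add_zero] at hij

/-- The positions on and below the diagonal of an `n × m` matrix. -/
abbrev LowerEntry (n m : ℕ) : Type := {p : Fin n × Fin m // (p.2 : ℕ) ≤ p.1}

theorem card_lowerEntry_add_choose (hmn : m ≤ n) :
    Fintype.card (LowerEntry n m) + m.choose 2 = n * m := by
  let e : {p : Fin n × Fin m // ¬ (p.2 : ℕ) ≤ p.1} ≃ Σ j : Fin m, Fin j :=
    { toFun := fun p => ⟨p.1.2, ⟨p.1.1, not_le.1 p.2⟩⟩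
      invFun := fun q => ⟨(⟨q.2, q.2.2.trans (q.1.2.trans_le hmn)⟩, q.1), not_le.2 q.2.2⟩
      left_inv := fun _ => rfl
      right_inv := fun _ => rfl }
  have hupper : Fintype.card {p : Fin n × Fin m // ¬ (p.2 : ℕ) ≤ p.1} = m.choose 2 := by
    simp only [Fintype.card_congr e, Fintype.card_sigma, Fintype.card_fin]
    rw [Fin.sum_univ_eq_sum_range (fun j => j) m, Finset.sum_range_id, Nat.choose_two_right]
  rw [← hupper, ← Fintype.card_sum, Fintype.card_congr (Equiv.sumCompl _), Fintype.card_prod,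
    Fintype.card_fin, Fintype.card_fin]

/-- The linear map that fills the positions on and below the diagonal other than `c` with a given
family of numbers, and all other positions with `0`. -/
def lowerFill (R : Type*) [Semiring R] (c : LowerEntry n m) :
    ({p : LowerEntry n m // p ≠ c} → R) →ₗ[R] Matrix (Fin n) (Fin m) R where
  toFun x := Matrix.of fun i j =>
    if h : ∃ hij : (j : ℕ) ≤ i, (⟨(i, j), hij⟩ : LowerEntry n m) ≠ c then x ⟨_, h.2⟩ else 0
  map_add' x y := by
    ext i j
    simp only [Matrix.of_apply, Matrix.add_apply]
    split_ifs <;> simp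
  map_smul' s x := by
    ext i j
    simp only [Matrix.of_apply, Matrix.smul_apply]
    split_ifs <;> simp

section Semiring

variable [Semiring R] (c : LowerEntry n m)

theorem lowerFill_apply_coe (x : {p : LowerEntry n m // p ≠ c} → R)
    (p : {p : LowerEntry n m // p ≠ c}) :
    lowerFill R c x p.1.1.1 p.1.1.2 = x p :=
  dif_pos ⟨p.1.2, p.2⟩

theorem lowerFill_apply_pivot (x : {p : LowerEntry n m // p ≠ c} → R) :
    lowerFill R c x c.1.1 c.1.2 = 0 :=
  dif_neg fun h => h.2 rfl

theorem isLowerTrapezoidal_lowerFill (x : {p : LowerEntry n m // p ≠ c} → R) :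
    IsLowerTrapezoidal (lowerFill R c x) :=
  fun _ _ hij => dif_neg fun h => hij.not_ge h.1

theorem lowerFill_injective : Function.Injective (lowerFill R c) := fun x y h =>
  funext fun p => by rw [← lowerFill_apply_coe c x, h, lowerFill_apply_coe]

/-- The lower trapezoidal matrix with entry `1` at the pivot `c` and the other entries on and below
the diagonal given by `x`. -/
def pivotMatrix (x : {p : LowerEntry n m // p ≠ c} → R) : Matrix (Fin n) (Fin m) R :=
  Matrix.single c.1.1 c.1.2 1 + lowerFill R c x

variable {c}

theorem IsLowerTrapezoidal.pivotMatrix_entries {L : Matrix (Fin n) (Fin m) R}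
    (hL : IsLowerTrapezoidal L) (hc : L c.1.1 c.1.2 = 1) :
    pivotMatrix c (fun p => L p.1.1.1 p.1.1.2) = L := by
  ext i j
  rw [pivotMatrix, Matrix.add_apply]
  by_cases hij : (j : ℕ) ≤ i
  · by_cases hp : (⟨(i, j), hij⟩ : LowerEntry n m) = c
    · subst hp
      rw [lowerFill_apply_pivot _ _, Matrix.single_apply_same, add_zero, hc]
    · rw [Matrix.single_apply_of_ne, zero_add, lowerFill_apply_coe c _ ⟨⟨(i, j), hij⟩, hp⟩]
      exact fun h => hp (Subtype.ext (Prod.ext h.1.symm h.2.symm))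
  · rw [isLowerTrapezoidal_lowerFill c _ i j (not_le.1 hij), hL i j (not_le.1 hij),
      Matrix.single_apply_of_ne, add_zero]
    rintro ⟨rfl, rfl⟩
    exact hij c.2

end Semiring

theorem IsLowerTrapezoidal.exists_eq_smul_pivotMatrix [DivisionSemiring R]
    [Nonempty (LowerEntry n m)] {L : Matrix (Fin n) (Fin m) R} (hL : IsLowerTrapezoidal L) :
    ∃ (s : R) (c : LowerEntry n m) (x : {p : LowerEntry n m // p ≠ c} → R),
      L = s • pivotMatrix c x := by
  by_cases h : ∃ c : LowerEntry n m, L c.1.1 c.1.2 ≠ 0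
  · obtain ⟨c, hc⟩ := h
    have hscaled : IsLowerTrapezoidal ((L c.1.1 c.1.2)⁻¹ • L) := fun i j hij => by
      simp [hL i j hij]
    refine ⟨L c.1.1 c.1.2, c, fun p => ((L c.1.1 c.1.2)⁻¹ • L) p.1.1.1 p.1.1.2, ?_⟩
    rw [hscaled.pivotMatrix_entries (by simp [hc]), smul_inv_smul₀ hc]
  · push Not at h
    have hL0 : L = 0 := Matrix.ext fun i j => (le_or_gt (j : ℕ) i).elim
      (fun hij => h ⟨(i, j), hij⟩) (hL i j)
    exact ⟨0, Classical.arbitrary _, 0, by rw [hL0, zero_smul]⟩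

end LowerTrapezoidal

section RectDiagonal

variable {R : Type*} {n m : ℕ}

/-- The `n × m` matrix with diagonal `d` and all other entries `0`. -/
def rectDiagonal [Zero R] (n : ℕ) (d : Fin m → R) : Matrix (Fin n) (Fin m) R :=
  Matrix.of fun i j => if (i : ℕ) = j then d j else 0

theorem isLowerTrapezoidal_rectDiagonal [Zero R] (d : Fin m → R) :
    IsLowerTrapezoidal (rectDiagonal n d) :=
  fun _ _ hij => if_neg hij.ne

theorem mul_transpose_rectDiagonal_apply [NonUnitalNonAssocSemiring R] {κ : Type*}
    (D : Matrix κ (Fin m) R) (d : Fin m → R) (a : κ) (b : Fin n) :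
    (D * (rectDiagonal n d)ᵀ) a b =
      if hb : (b : ℕ) < m then D a ⟨b, hb⟩ * d ⟨b, hb⟩ else 0 := by
  simp only [Matrix.mul_apply, Matrix.transpose_apply, rectDiagonal, Matrix.of_apply, mul_ite,
    mul_zero]
  split_ifs with hb
  · rw [Fintype.sum_eq_single ⟨b, hb⟩ fun j hj => if_neg fun h => hj (Fin.ext h.symm), if_pos rfl]
  · exact Finset.sum_eq_zero fun j _ => if_neg fun h : (b : ℕ) = j => hb (h ▸ j.2)

theorem transpose_rectDiagonal_mul_rectDiagonal [NonUnitalNonAssocSemiring R] (hmn : m ≤ n)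
    (d e : Fin m → R) :
    (rectDiagonal n d)ᵀ * rectDiagonal n e = Matrix.diagonal fun j => d j * e j := by
  ext i j
  rw [Matrix.mul_apply, Fintype.sum_eq_single (Fin.castLE hmn i)]
  · obtain rfl | hij := eq_or_ne i j
    · simp [rectDiagonal]
    · simp [rectDiagonal, hij, Fin.val_ne_of_ne hij]
  · intro a ha
    have hai : (a : ℕ) ≠ i := fun h => ha (Fin.ext h)
    simp [rectDiagonal, hai]

theorem IsLowerTrapezoidal.eq_zero_of_mul_transpose_rectDiagonal_add_transpose [Semiring R]
    [NoZeroDivisors R] [IsAddTorsionFree R] (hmn : m ≤ n) {d : Fin m → R} (hd : ∀ j, d j ≠ 0)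
    {D : Matrix (Fin n) (Fin m) R} (hD : IsLowerTrapezoidal D)
    (h : D * (rectDiagonal n d)ᵀ + (D * (rectDiagonal n d)ᵀ)ᵀ = 0) : D = 0 := by
  have hlower : IsLowerTrapezoidal (D * (rectDiagonal n d)ᵀ) := fun a b hab => by
    rw [mul_transpose_rectDiagonal_apply]
    split_ifs with hb
    · rw [hD a ⟨b, hb⟩ hab, zero_mul]
    · rfl
  have hzero := hlower.eq_zero_of_add_transpose_eq_zero h
  ext a b
  have hab := congrFun (congrFun hzero a) (Fin.castLE hmn b)
  rw [mul_transpose_rectDiagonal_apply] at hab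
  simpa [hd] using hab

end RectDiagonal

section Rigidity

variable {ι R : Type*} {α : ι → Type*} [Fintype ι] [DecidableEq ι] [∀ k, DecidableEq (α k)]
  [CommRing R] [TopologicalSpace R] [IsTopologicalSemiring R] {S T : ∀ k, Matrix (α k) (α k) R}
  {z : ∀ k, α k} {τ ρ : R}

theorem tangent_relation_factor (hS : ∀ k, S k (z k) (z k) = 1) (hT : ∀ k, T k (z k) (z k) = 0)
    (h : τ • piKronecker S + piKronecker.linearDeriv S T + ρ • 1 = 0) (k : ι) :
    τ • S k + T k + ρ • 1 = 0 := by
  ext a b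
  have hab := congrFun (congrFun h (Function.update z k a)) (Function.update z k b)
  simp only [Matrix.add_apply, Matrix.smul_apply, piKronecker_apply,
    piKronecker_linearDeriv_apply] at hab
  rw [Fintype.prod_eq_single k fun l hl => by simp [hl, hS],
    Fintype.sum_eq_single k fun l hl => by simp [hl, hT],
    Finset.prod_eq_one fun l hl => by simp [Finset.ne_of_mem_erase hl, hS]] at hab
  simpa [Matrix.one_apply, (Function.update_injective z k).eq_iff] using hab

theorem tangent_relation_pair (hS : ∀ k, S k (z k) (z k) = 1) (hT : ∀ k, T k (z k) (z k) = 0)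
    (h : τ • piKronecker S + piKronecker.linearDeriv S T + ρ • 1 = 0) {k l : ι}
    (hkl : k ≠ l) (a : α k) (b : α l) :
    τ * (S k a a * S l b b) + (S l b b * T k a a + S k a a * T l b b) + ρ = 0 := by
  let i := Function.update (Function.update z k a) l b
  have hik : i k = a := by simp [i, hkl]
  have hil : i l = b := by simp [i]
  have hiz : ∀ q, q ≠ k → q ≠ l → i q = z q := fun q hqk hql => by simp [i, hqk, hql]
  have hii := congrFun (congrFun h i) i
  simp only [Matrix.add_apply, Matrix.smul_apply, piKronecker_apply,
    piKronecker_linearDeriv_apply] at hii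
  rw [Fintype.prod_eq_mul k l hkl fun q hq => by rw [hiz q hq.1 hq.2, hS],
    Fintype.sum_eq_add k l hkl fun q hq => by rw [hiz q hq.1 hq.2, hT, mul_zero],
    Finset.prod_eq_single_of_mem l (by simp [hkl.symm]) fun q hq hql => by
      rw [hiz q (Finset.ne_of_mem_erase hq) hql, hS],
    Finset.prod_eq_single_of_mem k (by simp [hkl]) fun q hq hqk => by
      rw [hiz q hqk (Finset.ne_of_mem_erase hq), hS], hik, hil] at hii
  simpa using hii

theorem eq_zero_of_tangent_relation [NoZeroDivisors R]
    (hS : ∀ k, S k (z k) (z k) = 1) (hT : ∀ k, T k (z k) (z k) = 0)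
    (h : τ • piKronecker S + piKronecker.linearDeriv S T + ρ • 1 = 0)
    (hns : (∃ k a, S k a a = 0 ∧ T k a a = 0) ∨
      ∃ k l, k ≠ l ∧ (∃ a, S k a a ≠ 1) ∧ ∃ b, S l b b ≠ 1) :
    τ = 0 ∧ ρ = 0 ∧ T = 0 := by
  have hdiag k a : τ * S k a a + T k a a + ρ = 0 := by
    simpa using congrFun (congrFun (tangent_relation_factor hS hT h k) a) a
  have hsum (k : ι) : τ + ρ = 0 := by simpa [hS, hT] using hdiag k (z k)
  have hτρ : τ = 0 ∧ ρ = 0 := by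
    obtain ⟨k, a, hSa, hTa⟩ | ⟨k, l, hkl, ⟨a, ha⟩, b, hb⟩ := hns
    · have hρ : ρ = 0 := by simpa [hSa, hTa] using hdiag k a
      exact ⟨by linear_combination hsum k - hρ, hρ⟩
    · have hprod : τ * ((S k a a - 1) * (S l b b - 1)) = 0 := by
        linear_combination S l b b * hdiag k a + S k a a * hdiag l b -
          tangent_relation_pair hS hT h hkl a b + (1 - S k a a - S l b b) * hsum k
      have hτ : τ = 0 := by simpa [sub_ne_zero.2 ha, sub_ne_zero.2 hb] using hprod
      exact ⟨hτ, by linear_combination hsum k - hτ⟩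
  refine ⟨hτρ.1, hτρ.2, funext fun k => ?_⟩
  simpa [hτρ] using tangent_relation_factor hS hT h k

end Rigidity

section GaussianMoments

variable {ι κ : Type*} [Fintype ι]

theorem isBoundedBilinearMap_mul_transpose [Fintype κ] :
    IsBoundedBilinearMap ℝ fun p : Matrix κ ι ℝ × Matrix κ ι ℝ => p.1 * p.2ᵀ :=
  (LinearMap.mk₂ ℝ (fun A B : Matrix κ ι ℝ => A * Bᵀ) (by simp [Matrix.add_mul]) (by simp)
    (by simp [Matrix.mul_add]) (by simp)).toContinuousBilinearMap.isBoundedBilinearMap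

theorem isBoundedBilinearMap_toEuclideanLin [DecidableEq ι] [Fintype κ] :
    IsBoundedBilinearMap ℝ fun p : Matrix κ ι ℝ × EuclideanSpace ℝ ι =>
      Matrix.toEuclideanLin p.1 p.2 :=
  (Matrix.toEuclideanLin : Matrix κ ι ℝ ≃ₗ[ℝ] EuclideanSpace ℝ ι →ₗ[ℝ] EuclideanSpace ℝ κ
    ).toLinearMap.toContinuousBilinearMap.isBoundedBilinearMap

variable [DecidableEq ι] [DecidableEq κ]

/-- The mean and the covariance matrix of `B (ν + Z) + ε`, where `Z` is standard normal and
`ε ∼ N(0, σ² I)` is independent of `Z`. -/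
def gaussianMoments (B : Matrix κ ι ℝ) (ν : EuclideanSpace ℝ ι) (σ : ℝ) :
    EuclideanSpace ℝ κ × Matrix κ κ ℝ :=
  (Matrix.toEuclideanLin B ν, B * Bᵀ + σ ^ 2 • 1)

theorem gaussianMoments_mul {μ : Type*} [Fintype μ] [DecidableEq μ] (B : Matrix κ ι ℝ)
    {Q : Matrix ι μ ℝ} (hQ : Q * Qᵀ = 1) (ν : EuclideanSpace ℝ μ) (σ : ℝ) :
    gaussianMoments (B * Q) ν σ = gaussianMoments B (Matrix.toEuclideanLin Q ν) σ := by
  simp only [gaussianMoments, Matrix.toLpLin_mul_same, LinearMap.comp_apply,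
    Matrix.transpose_mul, Matrix.mul_assoc, ← Matrix.mul_assoc Q, hQ, Matrix.one_mul]

theorem gaussianMoments_abs (B : Matrix κ ι ℝ) (ν : EuclideanSpace ℝ ι) (σ : ℝ) :
    gaussianMoments B ν |σ| = gaussianMoments B ν σ := by
  simp only [gaussianMoments, sq_abs]

variable [Fintype κ]

theorem contDiff_gaussianMoments :
    ContDiff ℝ 1 fun p : Matrix κ ι ℝ × EuclideanSpace ℝ ι × ℝ =>
      gaussianMoments p.1 p.2.1 p.2.2 := by
  refine ContDiff.prodMk ?_ (ContDiff.add ?_ (by fun_prop))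
  · exact (isBoundedBilinearMap_toEuclideanLin (ι := ι) (κ := κ)).contDiff.comp
      (contDiff_fst.prodMk contDiff_snd.fst)
  · exact (isBoundedBilinearMap_mul_transpose (ι := ι) (κ := κ)).contDiff.comp
      (contDiff_fst.prodMk contDiff_fst)

theorem hasDerivAt_gaussianMoments {B : ℝ → Matrix κ ι ℝ} {B' : Matrix κ ι ℝ}
    {ν : ℝ → EuclideanSpace ℝ ι} {ν' : EuclideanSpace ℝ ι} {σ : ℝ → ℝ} {σ' t : ℝ}
    (hB : HasDerivAt B B' t) (hν : HasDerivAt ν ν' t) (hσ : HasDerivAt σ σ' t) :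
    HasDerivAt (fun u => gaussianMoments (B u) (ν u) (σ u))
      (Matrix.toEuclideanLin (B t) ν' + Matrix.toEuclideanLin B' (ν t),
        B t * B'ᵀ + B' * (B t)ᵀ + (2 * σ t * σ') • 1) t := by
  refine HasDerivAt.prodMk ?_ (HasDerivAt.add ?_ ?_)
  · exact (isBoundedBilinearMap_toEuclideanLin.hasFDerivAt (B t, ν t)).comp_hasDerivAt t
      (hB.prodMk hν)
  · exact (isBoundedBilinearMap_mul_transpose.hasFDerivAt (B t, B t)).comp_hasDerivAt t
      (hB.prodMk hB)
  · simpa using (hσ.fun_pow 2).smul_const (1 : Matrix κ κ ℝ)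

end GaussianMoments

section Probability

variable {Ω E : Type*} [MeasurableSpace Ω] {P : Measure Ω}

theorem covarianceBilin_map_apply_eq_cov [NormedAddCommGroup E] [InnerProductSpace ℝ E]
    [CompleteSpace E] [MeasurableSpace E] [BorelSpace E] [SecondCountableTopology E]
    [IsFiniteMeasure P] {X : Ω → E} (hX : MemLp X 2 P) (u v : E) :
    covarianceBilin (P.map X) u v =
      cov[fun ω => inner ℝ u (X ω), fun ω => inner ℝ v (X ω); P] := by
  have hXm := hX.aestronglyMeasurable.aemeasurable
  rw [covarianceBilin_apply_eq_cov ((memLp_map_measure_iff aestronglyMeasurable_id hXm).2 hX),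
    covariance_map_fun (by fun_prop) (by fun_prop) hXm]

theorem covarianceBilin_map_add [NormedAddCommGroup E] [InnerProductSpace ℝ E] [CompleteSpace E]
    [MeasurableSpace E] [BorelSpace E] [SecondCountableTopology E] [IsFiniteMeasure P]
    {X Y : Ω → E} (hX : MemLp X 2 P) (hY : MemLp Y 2 P) (hXY : IndepFun X Y P) :
    covarianceBilin (P.map (X + Y)) = covarianceBilin (P.map X) + covarianceBilin (P.map Y) := by
  ext u v
  have hXu := hX.const_inner (𝕜 := ℝ) u
  have hXv := hX.const_inner (𝕜 := ℝ) v
  have hYu := hY.const_inner (𝕜 := ℝ) u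
  have hYv := hY.const_inner (𝕜 := ℝ) v
  have cov_cross : ∀ u v, cov[fun ω => inner ℝ u (X ω), fun ω => inner ℝ v (Y ω); P] = 0 :=
    fun u v => (hXY.comp (φ := inner ℝ u) (ψ := inner ℝ v) (by fun_prop)
      (by fun_prop)).covariance_eq_zero (hX.const_inner u) (hY.const_inner v)
  simp only [add_apply, covarianceBilin_map_apply_eq_cov, hX.add hY, hX, hY, Pi.add_apply,
    inner_add_right]
  refine (covariance_add_left hXu hYu (hXv.add hYv)).trans ?_
  rw [covariance_add_right hXu hXv hYv, covariance_add_right hYu hXv hYv, cov_cross,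
    covariance_comm (fun ω => inner ℝ u (Y ω)), cov_cross, add_zero, zero_add]

theorem memLp_two_of_hasLaw [NormedAddCommGroup E] [NormedSpace ℝ E] [CompleteSpace E]
    [MeasurableSpace E] [BorelSpace E] [SecondCountableTopology E] {μ : Measure E} [IsGaussian μ]
    {X : Ω → E} (hX : HasLaw X μ P) : MemLp X 2 P := by
  have h := IsGaussian.memLp_two_id (μ := μ)
  rw [← hX.map_eq] at h
  exact (memLp_map_measure_iff aestronglyMeasurable_id hX.aemeasurable).1 h

variable {ι κ : Type*} [Fintype ι] [DecidableEq ι] [Fintype κ]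

theorem covarianceBilin_map_toEuclideanLin_stdGaussian (B : Matrix κ ι ℝ)
    (x y : EuclideanSpace ℝ κ) :
    covarianceBilin ((stdGaussian (EuclideanSpace ℝ ι)).map (Matrix.toEuclideanLin B)) x y =
      x.ofLp ⬝ᵥ (B * Bᵀ) *ᵥ y.ofLp := by
  classical
  let L := (Matrix.toEuclideanLin B).toContinuousLinearMap
  have hadj : ∀ z, L.adjoint z = Matrix.toEuclideanLin Bᵀ z := fun z => by
    rw [← Matrix.conjTranspose_eq_transpose_of_trivial,
      Matrix.toEuclideanLin_conjTranspose_eq_adjoint]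
    rfl
  refine (covarianceBilin_map IsGaussian.memLp_two_id L x y).trans ?_
  rw [covarianceBilin_stdGaussian, innerSL_apply_apply, EuclideanSpace.inner_eq_star_dotProduct,
    hadj, hadj, star_trivial, dotProduct_comm, Matrix.ofLp_toLpLin, Matrix.ofLp_toLpLin,
    Matrix.toLin'_apply, Matrix.toLin'_apply, Matrix.mulVec_transpose B x.ofLp,
    ← Matrix.dotProduct_mulVec, Matrix.mulVec_mulVec]

variable [DecidableEq κ] [IsProbabilityMeasure P] {Z : Ω → EuclideanSpace ℝ ι}
  {ε : Ω → EuclideanSpace ℝ κ} {σ : ℝ}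

theorem integral_linearModel (hZ : HasLaw Z (stdGaussian _) P)
    (hε : HasLaw ε (multivariateGaussian 0 (σ ^ 2 • (1 : Matrix κ κ ℝ))) P)
    (B : Matrix κ ι ℝ) (ν : EuclideanSpace ℝ κ) :
    ∫ ω, ν + Matrix.toEuclideanLin B (Z ω) + ε ω ∂P = ν := by
  have hZi : Integrable Z P := (memLp_two_of_hasLaw hZ).integrable one_le_two
  have hεi : Integrable ε P := (memLp_two_of_hasLaw hε).integrable one_le_two
  let L := (Matrix.toEuclideanLin B).toContinuousLinearMap
  have hLZi : Integrable (fun ω => L (Z ω)) P := L.integrable_comp hZi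
  change ∫ ω, ν + L (Z ω) + ε ω ∂P = ν
  rw [integral_add (f := fun ω => ν + L (Z ω)) ((integrable_const _).add hLZi) hεi,
    integral_add (integrable_const _) hLZi, L.integral_comp_comm hZi, hZ.integral_eq,
    integral_id_stdGaussian, hε.integral_eq, integral_id_multivariateGaussian]
  simp

theorem covarianceBilin_linearModel (hZ : HasLaw Z (stdGaussian _) P)
    (hε : HasLaw ε (multivariateGaussian 0 (σ ^ 2 • (1 : Matrix κ κ ℝ))) P)
    (hZε : IndepFun Z ε P) (B : Matrix κ ι ℝ) (ν x y : EuclideanSpace ℝ κ) :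
    covarianceBilin (P.map fun ω => ν + Matrix.toEuclideanLin B (Z ω) + ε ω) x y =
      x.ofLp ⬝ᵥ (B * Bᵀ + σ ^ 2 • 1) *ᵥ y.ofLp := by
  let L := (Matrix.toEuclideanLin B).toContinuousLinearMap
  have hLZ : MemLp (L ∘ Z) 2 P := L.comp_memLp' (memLp_two_of_hasLaw hZ)
  have hεL : MemLp ε 2 P := memLp_two_of_hasLaw hε
  have hLZε : IndepFun (L ∘ Z) ε P := hZε.comp (φ := L) (ψ := id) (by fun_prop) measurable_id
  have hsum : AEMeasurable (L ∘ Z + ε) P := (hLZ.add hεL).aestronglyMeasurable.aemeasurable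
  have hlaw : P.map (fun ω => ν + Matrix.toEuclideanLin B (Z ω) + ε ω) =
      (P.map (L ∘ Z + ε)).map (ν + ·) := by
    rw [AEMeasurable.map_map_of_aemeasurable (by fun_prop) hsum]
    exact congrArg P.map (funext fun ω => add_assoc _ _ _)
  have hmap : P.map (L ∘ Z) =
      (stdGaussian (EuclideanSpace ℝ ι)).map (Matrix.toEuclideanLin B) := by
    rw [← hZ.map_eq, ← AEMeasurable.map_map_of_aemeasurable (by fun_prop) hZ.aemeasurable]
    rfl
  have := Measure.isProbabilityMeasure_map hsum
  rw [hlaw, covarianceBilin_map_const_add, covarianceBilin_map_add hLZ hεL hLZε, hε.map_eq, hmap,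
    add_apply, add_apply, covarianceBilin_map_toEuclideanLin_stdGaussian,
    covarianceBilin_multivariateGaussian (Matrix.PosSemidef.one.smul (sq_nonneg σ)),
    Matrix.add_mulVec, dotProduct_add]

/-- The coordinates of a vector and of a bilinear form in the standard basis. -/
def formCoords (κ : Type*) [Fintype κ] [DecidableEq κ] :
    EuclideanSpace ℝ κ × (EuclideanSpace ℝ κ →L[ℝ] EuclideanSpace ℝ κ →L[ℝ] ℝ) →ₗ[ℝ]
      EuclideanSpace ℝ κ × Matrix κ κ ℝ where
  toFun p :=
    (p.1, LinearMap.BilinForm.toMatrix (EuclideanSpace.basisFun κ ℝ).toBasis p.2.toBilinForm)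
  map_add' p q := Prod.ext rfl (map_add _ p.2.toBilinForm q.2.toBilinForm)
  map_smul' s p := Prod.ext rfl (map_smul _ s p.2.toBilinForm)

theorem formCoords_injective (κ : Type*) [Fintype κ] [DecidableEq κ] :
    Function.Injective (formCoords κ) := fun _ _ h =>
  Prod.ext (congrArg Prod.fst h :) <|
    ContinuousLinearMap.toBilinForm_injective <| LinearEquiv.injective _ (congrArg Prod.snd h :)

theorem formCoords_linearModel (hZ : HasLaw Z (stdGaussian _) P)
    (hε : HasLaw ε (multivariateGaussian 0 (σ ^ 2 • (1 : Matrix κ κ ℝ))) P)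
    (hZε : IndepFun Z ε P) (B : Matrix κ ι ℝ) (ν : EuclideanSpace ℝ ι)
    {Q : Measure (EuclideanSpace ℝ κ)}
    (hQ : HasLaw (fun ω => Matrix.toEuclideanLin B ν + Matrix.toEuclideanLin B (Z ω) + ε ω) Q P) :
    formCoords κ (∫ x, x ∂Q, covarianceBilin Q) = gaussianMoments B ν σ := by
  refine Prod.ext (hQ.integral_eq.symm.trans (integral_linearModel hZ hε B _))
    (Matrix.ext fun i j => ?_)
  rw [← hQ.map_eq]
  refine (covarianceBilin_linearModel hZ hε hZε B _ _ _).trans ?_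
  simp [gaussianMoments]

/-- The means and the covariance matrices of the members of the tensor PCA model whose core mean
ranges over `N`. -/
def tpcaMoments {r : ℕ} (n m : Fin r → ℕ) (N : Set (Tensor m)) :
    Set (Tensor n × Matrix (∀ k, Fin (n k)) (∀ k, Fin (n k)) ℝ) :=
  {p | ∃ A : ∀ k, Matrix (Fin (n k)) (Fin (m k)) ℝ, ∃ ν ∈ N, ∃ σ, 0 ≤ σ ∧
    gaussianMoments (piKronecker A) ν σ = p}

theorem formCoords_image_meanCov_tpcaModel {r : ℕ} (n m : Fin r → ℕ) (N : Set (Tensor m)) :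
    formCoords _ '' (meanCov '' tpcaModel n m N) = tpcaMoments n m N := by
  ext p
  constructor
  · rintro ⟨_, ⟨Q, ⟨Ω, _, P, X, A, ν, σ, hP, hν, hσ, ⟨Z, ε, hZ, hε, hZε, hX⟩, hQ⟩, rfl⟩, rfl⟩
    obtain rfl : X = _ := funext hX
    exact ⟨A, ν, hν, σ, hσ, (formCoords_linearModel hZ hε hZε (piKronecker A) ν hQ).symm⟩
  · rintro ⟨A, ν, hν, σ, hσ, rfl⟩
    let P := (stdGaussian (Tensor m)).prod
      (multivariateGaussian (0 : Tensor n) (σ ^ 2 • (1 : Matrix _ _ ℝ)))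
    let X : Tensor m × Tensor n → Tensor n := fun ω => tucker A ν + tucker A ω.1 + ω.2
    have hZ : HasLaw Prod.fst (stdGaussian (Tensor m)) P := measurePreserving_fst.hasLaw
    have hε : HasLaw Prod.snd (multivariateGaussian 0 _) P := measurePreserving_snd.hasLaw
    have hZε : IndepFun Prod.fst Prod.snd P := indepFun_prod measurable_id measurable_id
    have hQ : HasLaw X (P.map X) P := by
      refine ⟨Measurable.aemeasurable ?_, rfl⟩
      simp only [X, tucker]
      fun_prop
    exact ⟨_, ⟨_, ⟨_, _, P, X, A, ν, σ, inferInstance, hν, hσ,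
      ⟨_, _, hZ, hε, hZε, fun _ => rfl⟩, hQ⟩, rfl⟩,
      formCoords_linearModel hZ hε hZε (piKronecker A) ν hQ⟩

end Probability

section HausdorffDimension

variable {E F : Type*} [NormedAddCommGroup E] [NormedSpace ℝ E]
  [NormedAddCommGroup F] [NormedSpace ℝ F] [FiniteDimensional ℝ F]

theorem dimH_image_of_injective {G : E →ₗ[ℝ] F} (hG : Function.Injective G) (s : Set E) :
    dimH (G '' s) = dimH s := by
  have : FiniteDimensional ℝ E := FiniteDimensional.of_injective G hG
  obtain ⟨K, -, hK⟩ := G.exists_antilipschitzWith (LinearMap.ker_eq_bot.2 hG)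
  exact ((LinearMap.toContinuousLinearMap G).lipschitz.dimH_image_le s).antisymm
    (hK.le_dimH_image s)

theorem finrank_le_dimH_range_of_hasStrictFDerivAt_injective [FiniteDimensional ℝ E] {f : E → F}
    {f' : E →L[ℝ] F} {a : E} (hf : HasStrictFDerivAt f f' a) (hf' : Function.Injective f') :
    (Module.finrank ℝ E : ℝ≥0∞) ≤ dimH (Set.range f) := by
  obtain ⟨H, hH⟩ := (f' : E →ₗ[ℝ] F).exists_leftInverse_of_injective (LinearMap.ker_eq_bot.2 hf')
  let g := LinearMap.toContinuousLinearMap H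
  have : CompleteSpace E := FiniteDimensional.complete ℝ E
  have hgf : HasStrictFDerivAt (g ∘ f) (g.comp f') a := g.hasStrictFDerivAt.comp a hf
  have hsurj : (g.comp f').range = ⊤ :=
    LinearMap.range_eq_top.2 fun x => ⟨x, LinearMap.congr_fun hH x⟩
  have hmem : Set.range (g ∘ f) ∈ nhds (g (f a)) :=
    hgf.map_nhds_eq_of_surj hsurj ▸ Filter.range_mem_map
  rw [← Real.dimH_of_mem_nhds hmem, Set.range_comp]
  exact g.lipschitz.dimH_image_le _

end HausdorffDimension

section Charts

variable {r : ℕ} {n m : Fin r → ℕ}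

/-- The parameters of the tensor PCA model after normalisation: every `A k` is lower trapezoidal
with entry `1` at `c k`, and is given by its remaining entries; the other parameters are the common
scale of the `A k`, the noise level and the core mean in `W`. -/
abbrev ChartSpace (c : ∀ k, LowerEntry (n k) (m k)) (W : Submodule ℝ (Tensor m)) : Type :=
  (∀ k, {p : LowerEntry (n k) (m k) // p ≠ c k} → ℝ) × ℝ × ℝ × W

/-- The moments of the member of the tensor PCA model with given normalised parameters. -/
def chart (c : ∀ k, LowerEntry (n k) (m k)) (W : Submodule ℝ (Tensor m)) (p : ChartSpace c W) :
    Tensor n × Matrix (∀ k, Fin (n k)) (∀ k, Fin (n k)) ℝ :=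
  gaussianMoments (p.2.1 • piKronecker fun k => pivotMatrix (c k) (p.1 k)) p.2.2.2 p.2.2.1

theorem contDiff_chart (c : ∀ k, LowerEntry (n k) (m k)) (W : Submodule ℝ (Tensor m)) :
    ContDiff ℝ 1 (chart c W) := by
  have hpivot : ContDiff ℝ 1 fun (p : ChartSpace c W) k => pivotMatrix (c k) (p.1 k) :=
    contDiff_pi.2 fun k => contDiff_const.add
      ((lowerFill ℝ (c k)).toContinuousLinearMap.contDiff.comp (contDiff_pi.1 contDiff_fst k))
  have hkron : ContDiff ℝ 1 fun A : ∀ k, Matrix (Fin (n k)) (Fin (m k)) ℝ => piKronecker A :=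
    (piKronecker : ContinuousMultilinearMap ℝ (fun k => Matrix (Fin (n k)) (Fin (m k)) ℝ)
      (Matrix (∀ k, Fin (n k)) (∀ k, Fin (m k)) ℝ)).contDiff
  have hparams : ContDiff ℝ 1 fun p : ChartSpace c W =>
      (p.2.1 • piKronecker fun k => pivotMatrix (c k) (p.1 k), (p.2.2.2 : Tensor m), p.2.2.1) :=
    (contDiff_snd.fst.smul (hkron.comp hpivot)).prodMk <|
      (W.subtypeL.contDiff.comp contDiff_snd.snd.snd).prodMk contDiff_snd.snd.fst
  exact (contDiff_gaussianMoments.comp hparams :)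

theorem finrank_chartSpace (hmn : ∀ k, m k ≤ n k) (c : ∀ k, LowerEntry (n k) (m k))
    (W : Submodule ℝ (Tensor m)) :
    (Module.finrank ℝ (ChartSpace c W) : ℤ) =
      2 + ∑ k, ((n k : ℤ) * (m k : ℤ) - ((m k).choose 2 : ℤ) - 1) + Module.finrank ℝ W := by
  have hcard : ∀ k, (Fintype.card {p : LowerEntry (n k) (m k) // p ≠ c k} : ℤ) =
      (n k : ℤ) * (m k : ℤ) - ((m k).choose 2 : ℤ) - 1 := fun k => by
    have hentries := card_lowerEntry_add_choose (hmn k)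
    have hpos : 0 < Fintype.card (LowerEntry (n k) (m k)) := Fintype.card_pos_iff.2 ⟨c k⟩
    have hpivot := Set.card_ne_eq (c k)
    simp only [Set.coe_ofPred] at hpivot
    rw [hpivot, Nat.cast_pred hpos, ← Nat.cast_mul, ← hentries, Nat.cast_add, add_sub_cancel_right]
  simp only [Module.finrank_prod, Module.finrank_pi_fintype, Module.finrank_self, ← hcard]
  push_cast
  simp only [Finset.sum_const, Finset.card_univ, nsmul_eq_mul, mul_one]
  ring

theorem tpcaMoments_subset_iUnion_range_chart (hm : ∀ k, 1 ≤ m k) (hmn : ∀ k, m k ≤ n k)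
    (W : Submodule ℝ (Tensor m))
    (hW : ∀ Q : ∀ k, Matrix (Fin (m k)) (Fin (m k)) ℝ, (∀ k, Q k * (Q k)ᵀ = 1) →
      ∀ ν ∈ W, tucker Q ν ∈ W) :
    tpcaMoments n m W ⊆ ⋃ c : ∀ k, LowerEntry (n k) (m k), Set.range (chart c W) := by
  rintro _ ⟨A, ν, hν, σ, -, rfl⟩
  have (k : Fin r) : Nonempty (LowerEntry (n k) (m k)) :=
    ⟨(⟨0, (hm k).trans (hmn k)⟩, ⟨0, hm k⟩), le_rfl⟩
  choose L Q hL hQ hA using fun k => exists_isLowerTrapezoidal_mul_orthogonal (hmn k) (A k)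
  choose s c x hx using fun k => (hL k).exists_eq_smul_pivotMatrix
  have hA' : piKronecker A =
      ((∏ k, s k) • piKronecker fun k => pivotMatrix (c k) (x k)) * piKronecker Q := by
    rw [← ContinuousMultilinearMap.map_smul_univ, piKronecker_mul]
    simp only [← hx, ← hA]
  refine Set.mem_iUnion.2 ⟨c, ⟨x, ∏ k, s k, σ, ⟨tucker Q ν, hW Q hQ ν hν⟩⟩, ?_⟩
  rw [hA', gaussianMoments_mul _ (piKronecker_mul_transpose_eq_one hQ), ← tucker_eq_toEuclideanLin]
  rfl

theorem range_chart_subset_tpcaMoments [NeZero r] (c : ∀ k, LowerEntry (n k) (m k))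
    (W : Submodule ℝ (Tensor m)) : Set.range (chart c W) ⊆ tpcaMoments n m W := by
  rintro _ ⟨⟨x, s, σ, ν⟩, rfl⟩
  let A := fun k => pivotMatrix (c k) (x k)
  refine ⟨Function.update A 0 (s • A 0), ν, ν.2, |σ|, abs_nonneg σ, ?_⟩
  rw [gaussianMoments_abs, ContinuousMultilinearMap.map_update_smul, Function.update_eq_self]
  rfl

end Charts

section Immersion

variable {r : ℕ} {n m : Fin r → ℕ}

theorem hasDerivAt_chart_add_smul (c : ∀ k, LowerEntry (n k) (m k)) (W : Submodule ℝ (Tensor m))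
    (x₀ x : ∀ k, {p : LowerEntry (n k) (m k) // p ≠ c k} → ℝ) (τ ρ : ℝ) (ν : W)
    {L D : ∀ k, Matrix (Fin (n k)) (Fin (m k)) ℝ} (hL : L = fun k => pivotMatrix (c k) (x₀ k))
    (hD : D = fun k => lowerFill ℝ (c k) (x k)) :
    HasDerivAt (fun t : ℝ => chart c W ((x₀, 1, 1, 0) + t • (x, τ, ρ, ν)))
      (Matrix.toEuclideanLin (piKronecker L) ν,
        (2 * τ) • piKronecker (fun k => L k * (L k)ᵀ) +
          piKronecker.linearDeriv (fun k => L k * (L k)ᵀ)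
            (fun k => L k * (D k)ᵀ + D k * (L k)ᵀ) + (2 * ρ) • 1) 0 := by
  have haffine (s : ℝ) : HasDerivAt (fun t : ℝ => 1 + t * s) s 0 := by
    simpa using ((hasDerivAt_id (0 : ℝ)).mul_const s).const_add 1
  have hline : HasDerivAt (fun t : ℝ => L + t • D) D 0 :=
    (((hasDerivAt_id (0 : ℝ)).smul_const D).const_add L).congr_deriv (one_smul ℝ D)
  have hkron : HasDerivAt (fun t : ℝ => piKronecker (L + t • D))
      (piKronecker.linearDeriv L D) 0 := by
    have h := (piKronecker (R := ℝ)).hasFDerivAt (x := L)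
    exact h.comp_hasDerivAt_of_eq 0 hline (by simp)
  have hscaled : HasDerivAt (fun t : ℝ => (1 + t * τ) • piKronecker (L + t • D))
      (piKronecker.linearDeriv L D + τ • piKronecker L) 0 :=
    ((haffine τ).fun_smul hkron).congr_deriv (by simp)
  have hν : HasDerivAt (fun t : ℝ => t • (ν : Tensor m)) ν 0 := by
    simpa using (hasDerivAt_id (0 : ℝ)).smul_const (ν : Tensor m)
  have hpivot (t : ℝ) : (fun k => pivotMatrix (c k) (x₀ k + t • x k)) = L + t • D := by
    subst hL hD
    funext k
    simp only [pivotMatrix, map_add, map_smul, add_assoc, Pi.add_apply, Pi.smul_apply]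
  convert hasDerivAt_gaussianMoments hscaled hν (haffine ρ) using 1
  · funext t
    simp only [chart, Prod.fst_add, Prod.snd_add, Prod.smul_fst, Prod.smul_snd, Pi.add_apply,
      Pi.smul_apply, smul_eq_mul, zero_add, Submodule.coe_smul, hpivot]
  · simp only [zero_mul, add_zero, zero_smul, one_smul, map_zero, mul_one,
      ← piKronecker_mul_transpose_linearDeriv_add, ← piKronecker_mul, ← transpose_piKronecker,
      Matrix.transpose_add, Matrix.transpose_smul, Matrix.mul_add, Matrix.add_mul, Matrix.mul_smul,
      Matrix.smul_mul]
    congr 1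
    module

/-- The position of the upper left entry. -/
def cornerEntry {n m : ℕ} (hm : 1 ≤ m) (hmn : m ≤ n) : LowerEntry n m :=
  ⟨(⟨0, hm.trans hmn⟩, ⟨0, hm⟩), le_rfl⟩

/-- The `n × m` matrix with diagonal `1, 2, 2, …`, at which the charts are shown to be immersions.
Its entry `1` at the corner is the normalised one; the other diagonal entries are neither `0` nor
`±1`. -/
def baseMatrix (n m : ℕ) : Matrix (Fin n) (Fin m) ℝ :=
  rectDiagonal n fun j => if (j : ℕ) = 0 then 1 else 2

theorem toEuclideanLin_piKronecker_baseMatrix_injective (hmn : ∀ k, m k ≤ n k) :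
    Function.Injective (Matrix.toEuclideanLin (piKronecker fun k => baseMatrix (n k) (m k))) := by
  let d (k : Fin r) (j : Fin (m k)) : ℝ := if (j : ℕ) = 0 then 1 else 2
  have hd k j : d k j ≠ 0 := by simp only [d]; split_ifs <;> norm_num
  refine toEuclideanLin_piKronecker_injective (B := fun k => (rectDiagonal (n k) (d k)⁻¹)ᵀ)
    fun k => (transpose_rectDiagonal_mul_rectDiagonal (hmn k) _ _).trans ?_
  simp [d, hd, ← Matrix.diagonal_one]

theorem mul_transpose_baseMatrix_apply_corner {κ : Type*} {n m : ℕ} (hm : 1 ≤ m) (hmn : m ≤ n)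
    (D : Matrix κ (Fin m) ℝ) (a : κ) :
    (D * (baseMatrix n m)ᵀ) a (cornerEntry hm hmn).1.1 = D a (cornerEntry hm hmn).1.2 := by
  simp [baseMatrix, cornerEntry, mul_transpose_rectDiagonal_apply, Nat.lt_of_succ_le hm]

theorem baseMatrix_mul_transpose_apply_self_ne_one {n m : ℕ} (hn : 2 ≤ n) :
    (baseMatrix n m * (baseMatrix n m)ᵀ) ⟨1, hn⟩ ⟨1, hn⟩ ≠ 1 := by
  simp only [baseMatrix, mul_transpose_rectDiagonal_apply]
  split_ifs <;> norm_num [rectDiagonal]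

theorem eq_zero_of_tangent_relation_baseMatrix (hm : ∀ k, 1 ≤ m k) (hmn : ∀ k, m k ≤ n k)
    (hns : (∃ k, m k < n k) ∨ ∃ k l, k ≠ l ∧ 2 ≤ n k ∧ 2 ≤ n l)
    {D : ∀ k, Matrix (Fin (n k)) (Fin (m k)) ℝ} (hD : ∀ k, IsLowerTrapezoidal (D k))
    (hcorner : ∀ k, D k (cornerEntry (hm k) (hmn k)).1.1 (cornerEntry (hm k) (hmn k)).1.2 = 0)
    {τ ρ : ℝ}
    (h : (2 * τ) • piKronecker (fun k => baseMatrix (n k) (m k) * (baseMatrix (n k) (m k))ᵀ) +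
      piKronecker.linearDeriv (fun k => baseMatrix (n k) (m k) * (baseMatrix (n k) (m k))ᵀ)
        (fun k => baseMatrix (n k) (m k) * (D k)ᵀ + D k * (baseMatrix (n k) (m k))ᵀ) +
      (2 * ρ) • 1 = 0) :
    τ = 0 ∧ ρ = 0 ∧ D = 0 := by
  have hsymm (k : Fin r) : baseMatrix (n k) (m k) * (D k)ᵀ + D k * (baseMatrix (n k) (m k))ᵀ =
      D k * (baseMatrix (n k) (m k))ᵀ + (D k * (baseMatrix (n k) (m k))ᵀ)ᵀ := by
    rw [Matrix.transpose_mul, Matrix.transpose_transpose, add_comm]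
  simp only [hsymm] at h
  have hcornerS (k : Fin r) : (baseMatrix (n k) (m k) * (baseMatrix (n k) (m k))ᵀ)
      (cornerEntry (hm k) (hmn k)).1.1 (cornerEntry (hm k) (hmn k)).1.1 = 1 := by
    rw [mul_transpose_baseMatrix_apply_corner]
    simp [baseMatrix, rectDiagonal, cornerEntry]
  have hcornerT (k : Fin r) : (D k * (baseMatrix (n k) (m k))ᵀ +
      (D k * (baseMatrix (n k) (m k))ᵀ)ᵀ)
      (cornerEntry (hm k) (hmn k)).1.1 (cornerEntry (hm k) (hmn k)).1.1 = 0 := by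
    simp only [Matrix.add_apply, Matrix.transpose_apply, mul_transpose_baseMatrix_apply_corner,
      hcorner, add_zero]
  have hextra {k : Fin r} (hk : m k < n k) (C : Matrix (Fin (n k)) (Fin (m k)) ℝ) :
      (C * (baseMatrix (n k) (m k))ᵀ) ⟨m k, hk⟩ ⟨m k, hk⟩ = 0 := by
    simp [baseMatrix, mul_transpose_rectDiagonal_apply]
  obtain ⟨hτ, hρ, hzero⟩ := eq_zero_of_tangent_relation hcornerS hcornerT h <|
    hns.imp (fun ⟨k, hk⟩ => ⟨k, ⟨m k, hk⟩, hextra hk _, by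
      rw [Matrix.add_apply, Matrix.transpose_apply, hextra hk, add_zero]⟩)
    fun ⟨k, l, hkl, hk, hl⟩ =>
      ⟨k, l, hkl, ⟨_, baseMatrix_mul_transpose_apply_self_ne_one hk⟩,
        _, baseMatrix_mul_transpose_apply_self_ne_one hl⟩
  refine ⟨(mul_eq_zero_iff_left two_ne_zero).1 hτ, (mul_eq_zero_iff_left two_ne_zero).1 hρ,
    funext fun k => ?_⟩
  refine (hD k).eq_zero_of_mul_transpose_rectDiagonal_add_transpose (hmn k) (fun j => ?_)
    (congrFun hzero k)
  split_ifs <;> norm_num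

theorem finrank_chartSpace_le_dimH_range (hm : ∀ k, 1 ≤ m k) (hmn : ∀ k, m k ≤ n k)
    (hns : (∃ k, m k < n k) ∨ ∃ k l, k ≠ l ∧ 2 ≤ n k ∧ 2 ≤ n l) (W : Submodule ℝ (Tensor m)) :
    (Module.finrank ℝ (ChartSpace (fun k => cornerEntry (hm k) (hmn k)) W) : ℝ≥0∞) ≤
      dimH (Set.range (chart (fun k => cornerEntry (hm k) (hmn k)) W)) := by
  let c k := cornerEntry (hm k) (hmn k)
  let L k := baseMatrix (n k) (m k)
  let x₀ k (p : {p : LowerEntry (n k) (m k) // p ≠ c k}) : ℝ := L k p.1.1.1 p.1.1.2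
  have hL : L = fun k => pivotMatrix (c k) (x₀ k) := funext fun k =>
    ((isLowerTrapezoidal_rectDiagonal _).pivotMatrix_entries
      (by simp [c, rectDiagonal, cornerEntry])).symm
  have hchart := ((contDiff_chart c W).contDiffAt (x := (x₀, 1, 1, 0))).hasStrictFDerivAt
    one_ne_zero
  refine finrank_le_dimH_range_of_hasStrictFDerivAt_injective hchart
    ((injective_iff_map_eq_zero _).2 ?_)
  rintro ⟨x, τ, ρ, ν⟩ hv
  let v : ChartSpace c W := (x, τ, ρ, ν)
  have hline : HasDerivAt (fun t : ℝ => chart c W ((x₀, 1, 1, 0) + t • v)) 0 0 := by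
    have h := (((hasDerivAt_id (0 : ℝ)).smul_const v).const_add (x₀, 1, 1, 0)).congr_deriv
      (one_smul ℝ v)
    exact (hchart.hasFDerivAt.comp_hasDerivAt_of_eq 0 h (by simp)).congr_deriv hv
  obtain ⟨hmean, hcov⟩ := Prod.mk_eq_zero.1 <|
    (hasDerivAt_chart_add_smul c W x₀ x τ ρ ν hL rfl).unique hline
  obtain ⟨rfl, rfl, hD⟩ := eq_zero_of_tangent_relation_baseMatrix hm hmn hns
    (fun k => isLowerTrapezoidal_lowerFill _ (x k)) (fun k => lowerFill_apply_pivot _ (x k)) hcov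
  have hx : x = 0 := funext fun k =>
    lowerFill_injective (c k) ((congrFun hD k).trans (map_zero _).symm)
  have hν : ν = 0 := Subtype.ext <|
    toEuclideanLin_piKronecker_baseMatrix_injective hmn (hmean.trans (map_zero _).symm)
  rw [hx, hν]
  rfl

end Immersion

theorem modelDim_tpcaModel_submodule {r d : ℕ} {n m : Fin r → ℕ} (hm : ∀ k, 1 ≤ m k)
    (hmn : ∀ k, m k ≤ n k) (hns : (∃ k, m k < n k) ∨ ∃ k l, k ≠ l ∧ 2 ≤ n k ∧ 2 ≤ n l)
    (W : Submodule ℝ (Tensor m))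
    (hW : ∀ Q : ∀ k, Matrix (Fin (m k)) (Fin (m k)) ℝ, (∀ k, Q k * (Q k)ᵀ = 1) →
      ∀ ν ∈ W, tucker Q ν ∈ W)
    (hd : (d : ℤ) = 2 + ∑ k, ((n k : ℤ) * (m k : ℤ) - ((m k).choose 2 : ℤ) - 1)) :
    modelDim (tpcaModel n m W) = ((d + Module.finrank ℝ W : ℕ) : ℝ≥0∞) := by
  have hrank (c : ∀ k, LowerEntry (n k) (m k)) :
      Module.finrank ℝ (ChartSpace c W) = d + Module.finrank ℝ W := by
    exact_mod_cast hd ▸ finrank_chartSpace hmn c W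
  have hmoments : modelDim (tpcaModel n m W) = dimH (tpcaMoments n m W) := by
    have hcoords := dimH_image_of_injective
      (E := Tensor n × (Tensor n →L[ℝ] Tensor n →L[ℝ] ℝ)) (formCoords_injective _)
      (meanCov '' tpcaModel n m W)
    rwa [formCoords_image_meanCov_tpcaModel, eq_comm] at hcoords
  rw [hmoments]
  refine le_antisymm ?_ ?_
  · refine (dimH_mono (tpcaMoments_subset_iUnion_range_chart hm hmn W hW)).trans ?_
    rw [dimH_iUnion]
    exact iSup_le fun c => hrank c ▸ (contDiff_chart c W).dimH_range_le
  · have : NeZero r := ⟨by rintro rfl; simp at hns⟩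
    rw [← hrank fun k => cornerEntry (hm k) (hmn k)]
    exact (finrank_chartSpace_le_dimH_range hm hmn hns W).trans
      (dimH_mono (range_chart_subset_tpcaMoments _ W))

end

theorem mainTheorem12 {r : ℕ} (n m : Fin r → ℕ)
    (hm : ∀ k, 1 ≤ m k) (hmn : ∀ k, m k ≤ n k)
    (hns : (∃ k, m k < n k) ∨ ∃ k l, k ≠ l ∧ 2 ≤ n k ∧ 2 ≤ n l) :
    ∃ d : ℕ,
      (d : ℤ) = 2 + ∑ k, ((n k : ℤ) * (m k : ℤ) - ((m k).choose 2 : ℤ) - 1) ∧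
      modelDim (tpcaModel n m {0}) = (d : ENNReal) ∧
      modelDim (tpcaModel n m Set.univ) = ((d + ∏ k, m k : ℕ) : ENNReal) := by
  obtain ⟨d, hd⟩ : ∃ d : ℕ,
      (d : ℤ) = 2 + ∑ k, ((n k : ℤ) * (m k : ℤ) - ((m k).choose 2 : ℤ) - 1) :=
    ⟨_, (finrank_chartSpace hmn (fun k => cornerEntry (hm k) (hmn k)) ⊥).trans (by simp)⟩
  refine ⟨d, hd, ?_, ?_⟩
  · have hbot := modelDim_tpcaModel_submodule hm hmn hns ⊥ (fun Q _ ν hν => ?_) hd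
    · simpa using hbot
    · rw [Submodule.mem_bot] at hν ⊢
      rw [hν, tucker_eq_toEuclideanLin, map_zero]
  · have htop := modelDim_tpcaModel_submodule hm hmn hns ⊤ (fun _ _ _ _ => Submodule.mem_top) hd
    simpa using htop
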